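/- Let $(X,d)$ be a compact metric space and let $\phi:X\times\mathbb{R}\to X$ be a continuous flow, i.e. a continuous map such that, with $\phi_t=\phi(\cdot,t)$, one has $\phi_t\circ\phi_s=\phi_{t+s}$ for all $s,t\in\mathbb{R}$ and $\phi_0=\mathrm{id}$. Assume that $\phi$ has no fixed points: for every $x\in X$ there is $t\in\mathbb{R}$ with $\phi_t x\neq x$. For $t>0$ let $\mathrm{Rep}[0,t]$ be the set of all maps $\alpha:[0,t]\to\mathbb{R}$ that are homeomorphisms onto their image and satisfy $\alpha(0)=0$. For $x\in X$, $t>0$, $\varepsilon>0$ define the reparametrization ball $$B(x,t,\varepsilon,\phi)=\{y\in X:\ \exists\,\alpha\in \mathrm{Rep}[0,t]\ \text{with}\ d(\phi_{\alpha(s)}x,\phi_s y)<\varepsilon\ \text{for all}\ 0\le s\le t\},$$ and let the closed reparametrization ball $\overline{B}(x,t,\varepsilon,\phi)$ be defined in the same way with $\le\varepsilon$ in place of $<\varepsilon$. *Packing topological entropy.* For $Z\subset X$, $s\ge 0$, $N\in\mathbb{N}$ and $\varepsilon>0$ let $$P^s_{N,\varepsilon}(\phi,Z)=\sup\sum_i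 e^{-s t_i},$$ where the supremum is over all finite or countable families of pairwise disjoint closed reparametrization balls $\{\overline{B}(x_i,t_i,\varepsilon,\phi)\}$ with $x_i\in Z$, $t_i>0$ and $t_i\ge N$. Put $P^s_\varepsilon(\phi,Z)=\lim_{N\to\infty}P^s_{N,\varepsilon}(\phi,Z)$ and $$\mathcal{P}^s_\varepsilon(Z)=\inf\Big\{\sum_{i=1}^\infty P^s_\varepsilon(\phi,Z_i):\ Z\subset\bigcup_{i=1}^\infty Z_i\Big\},$$ $$h^P_{\mathrm{top}}(\phi,Z,\varepsilon)=\inf\{s\ge 0:\mathcal{P}^s_\varepsilon(Z)=0\}=\sup\{s\ge 0:\mathcal{P}^s_\varepsilon(Z)=\infty\},\qquad h^P_{\mathrm{top}}(\phi,Z)=\lim_{\varepsilon\to0}h^P_{\mathrm{top}}(\phi,Z,\varepsilon)\in[0,\infty],$$ with $\inf\emptyset=\infty$ and $\sup\emptyset=0$. *Upper local entropy.* Let $M(X)$ be the set of Borel probability measures on $X$. For $\mu\in M(X)$ and $x\in X$ let $$\overline{h}_\mu(\phi,x)=\lim_{\varepsilon\to0}\limsup_{t\to+\infty}-\frac1t\log\mu(B(x,t,\varepsilon,\phi)),\qquad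 \overline{h}_\mu(\phi)=\int\overline{h}_\mu(\phi,x)\,d\mu(x)\in[0,\infty],$$ with $\log 0=-\infty$. **Theorem.** For every non-empty compact set $K\subset X$, $$h^P_{\mathrm{top}}(\phi,K)=\sup\{\overline{h}_\mu(\phi):\ \mu\in M(X),\ \mu(K)=1\},$$ as an equality in $[0,\infty]$. -/

import Mathlib

open Set Filter Topology MeasureTheory
open scoped ENNReal NNReal

namespace FlowEntropy

variable {X : Type*} [MetricSpace X]

/-- The flow `φ` has no fixed points: no point is fixed by every `φ_t`. -/
def NoFixedPoints (φ : Flow ℝ X) : Prop :=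
  ∀ x : X, ∃ t : ℝ, φ t x ≠ x

/-- The reparametrizations of an interval `I` that contains the origin: maps `α : I → ℝ` which are
homeomorphisms onto their image, with `α 0 = 0`. A map on `I` is represented by a function on `ℝ`
of which only the restriction to `I` is ever used. -/
def Rep (I : Set ℝ) : Set (ℝ → ℝ) :=
  {α | IsEmbedding (I.domRestrict α) ∧ α 0 = 0}

/-- The (open) reparametrization ball `B(x, t, ε, φ)`. -/
def repBall (φ : Flow ℝ X) (x : X) (t ε : ℝ) : Set X :=
  {y | ∃ α ∈ Rep (Icc 0 t), ∀ s ∈ Icc 0 t, dist (φ (α s) x) (φ s y) < ε}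

/-- The closed reparametrization ball, defined with `≤ ε`. -/
def closedRepBall (φ : Flow ℝ X) (x : X) (t ε : ℝ) : Set X :=
  {y | ∃ α ∈ Rep (Icc 0 t), ∀ s ∈ Icc 0 t, dist (φ (α s) x) (φ s y) ≤ ε}

/-- A packing of order `N` at scale `ε` centred in `Z`: a finite or countable family of pairwise
disjoint closed reparametrization balls with centres in `Z` and times `t > 0`, `t ≥ N`. The family
is given by the set of its pairs (centre, time). -/
structure IsPacking (φ : Flow ℝ X) (Z : Set X) (ε : ℝ) (N : ℕ) (F : Set (X × ℝ)) : Prop where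
  countable : F.Countable
  center_mem : ∀ p ∈ F, p.1 ∈ Z
  time_pos : ∀ p ∈ F, 0 < p.2
  le_time : ∀ p ∈ F, (N : ℝ) ≤ p.2
  disjoint : F.PairwiseDisjoint fun p => closedRepBall φ p.1 p.2 ε

/-- `P^s_{N,ε}(φ, Z)`: the supremum of `∑ exp(-s t_i)` over packings. -/
noncomputable def packingPreAt (φ : Flow ℝ X) (s : ℝ≥0) (ε : ℝ) (N : ℕ) (Z : Set X) : ℝ≥0∞ :=
  ⨆ (F : Set (X × ℝ)) (_ : IsPacking φ Z ε N F), ∑' p : F, ENNReal.ofReal (Real.exp (-s * p.1.2))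

/-- `P^s_ε(φ, Z)`: the limit of the nonincreasing sequence `P^s_{N,ε}(φ, Z)` as `N → ∞`
(see `tendsto_packingPreAt`). -/
noncomputable def packingPre (φ : Flow ℝ X) (s : ℝ≥0) (ε : ℝ) (Z : Set X) : ℝ≥0∞ :=
  ⨅ N : ℕ, packingPreAt φ s ε N Z

/-- `𝒫^s_ε(Z)`: the infimum of `∑ P^s_ε(φ, Z_i)` over countable covers of `Z` by arbitrary sets. -/
noncomputable def packingMeas (φ : Flow ℝ X) (s : ℝ≥0) (ε : ℝ) (Z : Set X) : ℝ≥0∞ :=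
  ⨅ (W : ℕ → Set X) (_ : Z ⊆ ⋃ i, W i), ∑' i, packingPre φ s ε (W i)

/-- `h^P_top(φ, Z, ε) = inf {s ≥ 0 : 𝒫^s_ε(Z) = 0}`, with `inf ∅ = ∞`; it is also
`sup {s ≥ 0 : 𝒫^s_ε(Z) = ∞}` (see `packingEntropyAt_eq_sup`). -/
noncomputable def packingEntropyAt (φ : Flow ℝ X) (Z : Set X) (ε : ℝ) : ℝ≥0∞ :=
  ⨅ (s : ℝ≥0) (_ : packingMeas φ s ε Z = 0), (s : ℝ≥0∞)

/-- The packing topological entropy `h^P_top(φ, Z)`: the limit of `h^P_top(φ, Z, ε)` as `ε ↓ 0`,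
which is a supremum by monotonicity (see `tendsto_packingEntropyAt`). -/
noncomputable def packingEntropy (φ : Flow ℝ X) (Z : Set X) : ℝ≥0∞ :=
  ⨆ (ε : ℝ) (_ : 0 < ε), packingEntropyAt φ Z ε

/-- `limsup_{t → +∞} -(1/t) log μ(B(x, t, ε, φ))`, with `log 0 = -∞`. -/
noncomputable def upperLocalEntropyAt [MeasurableSpace X] (φ : Flow ℝ X) (μ : Measure X)
    (x : X) (ε : ℝ) : EReal :=
  limsup (fun t : ℝ => ((-(1 / t) : ℝ) : EReal) * ENNReal.log (μ (repBall φ x t ε))) atTop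

/-- The upper local entropy `h̄_μ(φ, x)`: the limit of the previous quantity as `ε ↓ 0`,
which is a supremum by monotonicity (see `tendsto_upperLocalEntropyAt`). -/
noncomputable def upperLocalEntropy [MeasurableSpace X] (φ : Flow ℝ X) (μ : Measure X)
    (x : X) : EReal :=
  ⨆ (ε : ℝ) (_ : 0 < ε), upperLocalEntropyAt φ μ x ε

/-- The integrated upper local entropy `h̄_μ(φ) = ∫ h̄_μ(φ, x) dμ(x)` in `[0, ∞]`; the integrand is
nonnegative when `μ` is a probability measure (see `upperLocalEntropy_nonneg`). -/
noncomputable def upperEntropy [MeasurableSpace X] (φ : Flow ℝ X) (μ : Measure X) : ℝ≥0∞ :=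
  ∫⁻ x, (upperLocalEntropy φ μ x).toENNReal ∂μ

/-! ### The limits and critical values above are well defined -/

theorem repBall_mono (φ : Flow ℝ X) (x : X) (t : ℝ) {ε ε' : ℝ} (h : ε ≤ ε') :
    repBall φ x t ε ⊆ repBall φ x t ε' := by
  rintro y ⟨α, hα, hy⟩
  exact ⟨α, hα, fun s hs => (hy s hs).trans_le h⟩

theorem closedRepBall_mono (φ : Flow ℝ X) (x : X) (t : ℝ) {ε ε' : ℝ} (h : ε ≤ ε') :
    closedRepBall φ x t ε ⊆ closedRepBall φ x t ε' := by
  rintro y ⟨α, hα, hy⟩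
  exact ⟨α, hα, fun s hs => (hy s hs).trans h⟩

theorem mem_repBall_self (φ : Flow ℝ X) (x : X) (t : ℝ) {ε : ℝ} (h : 0 < ε) :
    x ∈ repBall φ x t ε :=
  ⟨id, ⟨IsEmbedding.subtypeVal, rfl⟩, fun s _ => by simpa using h⟩

theorem packingPreAt_antitone (φ : Flow ℝ X) (s : ℝ≥0) (ε : ℝ) (Z : Set X) :
    Antitone fun N => packingPreAt φ s ε N Z := by
  intro N M hNM
  refine iSup₂_le fun F hF => le_iSup₂_of_le F ?_ le_rfl
  exact { hF with le_time := fun p hp => (Nat.cast_le.2 hNM).trans (hF.le_time p hp) }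

theorem tendsto_packingPreAt (φ : Flow ℝ X) (s : ℝ≥0) (ε : ℝ) (Z : Set X) :
    Tendsto (fun N => packingPreAt φ s ε N Z) atTop (𝓝 (packingPre φ s ε Z)) :=
  tendsto_atTop_iInf (packingPreAt_antitone φ s ε Z)

theorem packingMeas_antitone_scale (φ : Flow ℝ X) (s : ℝ≥0) (Z : Set X) :
    Antitone fun ε => packingMeas φ s ε Z := by
  intro ε ε' h
  refine iInf₂_mono fun W _ => ENNReal.tsum_le_tsum fun i => iInf_mono fun N => ?_
  refine iSup₂_le fun F hF => le_iSup₂_of_le F ?_ le_rfl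
  exact { hF with disjoint := hF.disjoint.mono fun p => closedRepBall_mono φ p.1 p.2 h }

theorem packingEntropyAt_antitone (φ : Flow ℝ X) (Z : Set X) :
    Antitone (packingEntropyAt φ Z) := by
  intro ε ε' h
  refine le_iInf₂ fun s hs => iInf₂_le s ?_
  exact le_antisymm ((packingMeas_antitone_scale φ s Z h).trans hs.le) bot_le

theorem tendsto_iSup_of_antitone {β : Type*} [CompleteLinearOrder β] [TopologicalSpace β]
    [OrderTopology β] {f : ℝ → β} (hf : Antitone f) :
    Tendsto f (𝓝[>] 0) (𝓝 (⨆ (ε : ℝ) (_ : 0 < ε), f ε)) := by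
  refine tendsto_order.2 ⟨fun a ha => ?_, fun a ha => ?_⟩
  · obtain ⟨ε, hε⟩ := lt_iSup_iff.1 ha
    obtain ⟨h0, hε⟩ := lt_iSup_iff.1 hε
    filter_upwards [Ioo_mem_nhdsGT h0] with δ hδ using hε.trans_le (hf hδ.2.le)
  · filter_upwards [self_mem_nhdsWithin] with δ hδ
    exact (le_iSup₂ (f := fun (ε : ℝ) (_ : 0 < ε) => f ε) δ hδ).trans_lt ha

theorem tendsto_packingEntropyAt (φ : Flow ℝ X) (Z : Set X) :
    Tendsto (packingEntropyAt φ Z) (𝓝[>] 0) (𝓝 (packingEntropy φ Z)) :=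
  tendsto_iSup_of_antitone (packingEntropyAt_antitone φ Z)

theorem packingPreAt_le_mul (φ : Flow ℝ X) {s s' : ℝ≥0} (h : s ≤ s') (ε : ℝ) (N : ℕ) (Z : Set X) :
    packingPreAt φ s' ε N Z ≤
      ENNReal.ofReal (Real.exp (-(s' - s) * N)) * packingPreAt φ s ε N Z := by
  refine iSup₂_le fun F hF => ?_
  refine le_trans ?_ (mul_le_mul_right (le_iSup₂_of_le F hF le_rfl) _)
  rw [← ENNReal.tsum_mul_left]
  refine ENNReal.tsum_le_tsum fun p => ?_
  rw [← ENNReal.ofReal_mul (Real.exp_pos _).le, ← Real.exp_add]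
  refine ENNReal.ofReal_le_ofReal (Real.exp_le_exp.2 ?_)
  have h1 : (s : ℝ) ≤ s' := by exact_mod_cast h
  nlinarith [hF.le_time p.1 p.2]

theorem packingPre_eq_zero (φ : Flow ℝ X) {s s' : ℝ≥0} (h : s < s') (ε : ℝ) (Z : Set X)
    (hZ : packingPre φ s ε Z ≠ ∞) : packingPre φ s' ε Z = 0 := by
  have h1 : (0 : ℝ) < s' - s := sub_pos.2 (by exact_mod_cast h)
  have h2 : Tendsto (fun N : ℕ => ENNReal.ofReal (Real.exp (-((s' : ℝ) - s) * N))) atTop (𝓝 0) := by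
    rw [← ENNReal.ofReal_zero]
    refine ENNReal.tendsto_ofReal (Real.tendsto_exp_atBot.comp ?_)
    exact tendsto_natCast_atTop_atTop.const_mul_atTop_of_neg (by linarith)
  have h3 := ENNReal.Tendsto.mul h2 (Or.inr hZ) (tendsto_packingPreAt φ s ε Z)
    (Or.inr ENNReal.zero_ne_top)
  rw [zero_mul] at h3
  exact le_antisymm (le_of_tendsto_of_tendsto' (tendsto_packingPreAt φ s' ε Z) h3
    fun N => packingPreAt_le_mul φ h.le ε N Z) bot_le

theorem packingMeas_eq_zero (φ : Flow ℝ X) {s s' : ℝ≥0} (h : s < s') (ε : ℝ) (Z : Set X)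
    (hZ : packingMeas φ s ε Z ≠ ∞) : packingMeas φ s' ε Z = 0 := by
  obtain ⟨W, hW⟩ := iInf_lt_iff.1 (lt_top_iff_ne_top.2 hZ)
  obtain ⟨hc, hW⟩ := iInf_lt_iff.1 hW
  refine le_antisymm (iInf₂_le_of_le W hc (le_of_eq ?_)) bot_le
  exact ENNReal.tsum_eq_zero.2 fun i =>
    packingPre_eq_zero φ h ε (W i) (ENNReal.ne_top_of_tsum_ne_top hW.ne i)

theorem packingEntropyAt_eq_sup (φ : Flow ℝ X) (Z : Set X) (ε : ℝ) :
    packingEntropyAt φ Z ε = ⨆ (s : ℝ≥0) (_ : packingMeas φ s ε Z = ∞), (s : ℝ≥0∞) := by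
  refine le_antisymm (le_of_forall_lt fun a ha => ?_)
    (iSup₂_le fun s hs => le_iInf₂ fun s' hs' => ?_)
  · obtain ⟨b, hab, hb⟩ := ENNReal.lt_iff_exists_nnreal_btwn.1 ha
    obtain ⟨c, hbc, hc⟩ := ENNReal.lt_iff_exists_nnreal_btwn.1 hb
    refine hab.trans_le (le_iSup₂_of_le b ?_ le_rfl)
    by_contra hne
    exact absurd (iInf₂_le c (packingMeas_eq_zero φ (by exact_mod_cast hbc) ε Z hne)) (not_le.2 hc)
  · by_contra hlt
    have hlt' : s' < s := by exact_mod_cast not_le.1 hlt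
    have := packingMeas_eq_zero φ hlt' ε Z (by rw [hs']; exact ENNReal.zero_ne_top)
    rw [hs] at this
    exact ENNReal.top_ne_zero this

theorem upperLocalEntropyAt_antitone [MeasurableSpace X] (φ : Flow ℝ X) (μ : Measure X) (x : X) :
    Antitone (upperLocalEntropyAt φ μ x) := by
  intro ε ε' h
  refine limsup_le_limsup ?_
  filter_upwards [eventually_gt_atTop 0] with t ht
  have h1 : ENNReal.log (μ (repBall φ x t ε)) ≤ ENNReal.log (μ (repBall φ x t ε')) :=
    ENNReal.log_monotone (measure_mono (repBall_mono φ x t h))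
  have h2 : (0 : EReal) ≤ ((1 / t : ℝ) : EReal) := EReal.coe_nonneg.2 (by positivity)
  simp only [EReal.coe_neg, EReal.neg_mul, EReal.neg_le_neg_iff]
  exact mul_le_mul_of_nonneg_left h1 h2

theorem tendsto_upperLocalEntropyAt [MeasurableSpace X] (φ : Flow ℝ X) (μ : Measure X) (x : X) :
    Tendsto (upperLocalEntropyAt φ μ x) (𝓝[>] 0) (𝓝 (upperLocalEntropy φ μ x)) :=
  tendsto_iSup_of_antitone (upperLocalEntropyAt_antitone φ μ x)

theorem upperLocalEntropy_nonneg [MeasurableSpace X] (φ : Flow ℝ X) (μ : Measure X)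
    [IsProbabilityMeasure μ] (x : X) : 0 ≤ upperLocalEntropy φ μ x := by
  refine le_iSup₂_of_le 1 one_pos (le_limsup_of_frequently_le (Eventually.frequently ?_))
  filter_upwards [eventually_gt_atTop 0] with t ht
  have h1 : ENNReal.log (μ (repBall φ x t 1)) ≤ 0 := by
    rw [← ENNReal.log_one]
    exact ENNReal.log_monotone prob_le_one
  have h2 : (0 : EReal) ≤ ((1 / t : ℝ) : EReal) := EReal.coe_nonneg.2 (by positivity)
  simp only [EReal.coe_neg, EReal.neg_mul]
  rw [EReal.le_neg, neg_zero]
  exact mul_nonpos_of_nonneg_of_nonpos h2 h1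

end FlowEntropy

namespace FlowEntropy

variable {X : Type*} [MetricSpace X]

/-! Compactness and the absence of fixed points exclude small periods, so a reparametrization that
shadows at a small scale satisfies |α s - s| ≤ η (s + 1) (`exists_abs_sub_le_of_shadow`).
Reparametrization balls thus behave like Bowen balls up to a small proportion of time.

Local entropy is bounded by packing entropy: where the upper local entropy at a fixed scale exceeds
s, arbitrarily large T satisfy μ(B(x, T, 3δ)) ≤ exp(-sT). A Vitali selection gives disjoint closed
balls of scale δ whose enlargements cover, so the packing premeasure at an exponent slightly below s
dominates μ (`IsShadowScale.measure_le_packingPre`). If that exponent is still above the packing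
entropy, such points form a null set.

Conversely, below the packing entropy, K contains a set Z near each of whose points there are finite
packings of every order with exponential sum at least 1. Nesting such packings and splitting weights
proportionally (`Stage.exists_refines`) gives finitely supported measures; a limit μ inherits μ(B(z,
T, ε)) ≤ exp(-sT) for arbitrarily large T at almost every z
(`exists_measure_frequently_repBall_le`). -/

/-! ### Rigidity of reparametrizations for fixed-point free flows -/

theorem flow_nat_mul_of_fixed (φ : Flow ℝ X) {p : ℝ} {x : X} (h : φ p x = x) (n : ℕ) :
    φ (n * p) x = x := by
  induction n with
  | zero => simp
  | succ n ih => rw [Nat.cast_succ, add_mul, one_mul, φ.map_add, h, ih]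

/-- A fixed-point free flow on a compact space has no arbitrarily small periods. -/
theorem exists_forall_ne_of_noFixedPoints [CompactSpace X] {φ : Flow ℝ X} (hφ : NoFixedPoints φ) :
    ∃ T > 0, T ≤ 1 ∧ ∀ x : X, ∀ p : ℝ, 0 < p → p ≤ T → φ p x ≠ x := by
  have key : ∀ᶠ p : ℝ in 𝓝 0, ∀ x ∈ (univ : Set X), 0 < p → φ p x ≠ x := by
    refine isCompact_univ.eventually_forall_of_forall_eventually fun x _ => ?_
    obtain ⟨t, ht⟩ : ∃ t : ℝ, 0 < t ∧ φ t x ≠ x := by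
      obtain ⟨t, ht⟩ := hφ x
      rcases lt_trichotomy t 0 with h | rfl | h
      · refine ⟨-t, by linarith, fun h' => ht ?_⟩
        nth_rw 1 [← h']
        rw [← φ.map_add]
        simp
      · simp at ht
      · exact ⟨t, h, ht⟩
    have hU : ∀ᶠ q : ℝ × X in 𝓝 (t, x), φ q.1 q.2 ≠ q.2 :=
      (isOpen_ne_fun (φ.continuous continuous_fst continuous_snd) continuous_snd).mem_nhds ht.2
    obtain ⟨δ, hδ, hball⟩ := Metric.eventually_nhds_iff.1 hU
    refine Metric.eventually_nhds_iff.2 ⟨δ, hδ, ?_⟩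
    rintro ⟨p, y⟩ hpy hp hfix
    simp only [Prod.dist_eq, max_lt_iff] at hpy hball hp hfix
    rw [Real.dist_eq, sub_zero, abs_of_pos hp] at hpy
    -- A point of small period p is fixed by a multiple of p within p of t, although nothing near x
    -- is fixed at times near t.
    refine hball (y := (⌊t / p⌋₊ * p, y)) ⟨?_, hpy.2⟩ (flow_nat_mul_of_fixed φ hfix _)
    have h1 := Nat.floor_le (div_nonneg ht.1.le hp.le)
    have h2 := Nat.lt_floor_add_one (t / p)
    rw [le_div_iff₀ hp] at h1
    rw [div_lt_iff₀ hp] at h2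
    rw [Real.dist_eq, abs_lt]
    constructor <;> linarith
  obtain ⟨δ, hδ, h⟩ := Metric.eventually_nhds_iff.1 key
  refine ⟨min (δ / 2) 1, by positivity, min_le_right _ _, fun x p hp hpT => h ?_ x (mem_univ x) hp⟩
  rw [Real.dist_eq, sub_zero, abs_of_pos hp]
  linarith [min_le_left (δ / 2) 1]

/-- Along short orbit segments of a fixed-point free flow, closeness determines the time. -/
theorem exists_dist_time_lt [CompactSpace X] {φ : Flow ℝ X} {T : ℝ}
    (hT : ∀ x : X, ∀ p : ℝ, 0 < p → p ≤ T → φ p x ≠ x) {η : ℝ} (hη : 0 < η) :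
    ∃ θ > 0, ∀ x y : X, ∀ u ∈ Icc (-(T / 2)) (T / 2), ∀ v ∈ Icc (-(T / 2)) (T / 2),
      dist x y ≤ θ → dist (φ u x) (φ v y) ≤ θ → |u - v| < η := by
  let I := Icc (-(T / 2)) (T / 2)
  let D : Set ((ℝ × ℝ) × (X × X)) := ((I ×ˢ I) ×ˢ univ) ∩ {q | η ≤ |q.1.1 - q.1.2|}
  have hD : IsCompact D := ((isCompact_Icc.prod isCompact_Icc).prod isCompact_univ).inter_right
    (isClosed_le continuous_const (by fun_prop))
  let g : ((ℝ × ℝ) × (X × X)) → ℝ := fun q =>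
    max (dist q.2.1 q.2.2) (dist (φ q.1.1 q.2.1) (φ q.1.2 q.2.2))
  have hg : Continuous g := by
    have h1 : Continuous fun q : (ℝ × ℝ) × (X × X) => φ q.1.1 q.2.1 :=
      φ.continuous (by fun_prop) (by fun_prop)
    have h2 : Continuous fun q : (ℝ × ℝ) × (X × X) => φ q.1.2 q.2.2 :=
      φ.continuous (by fun_prop) (by fun_prop)
    exact (by fun_prop : Continuous fun q : (ℝ × ℝ) × (X × X) => dist q.2.1 q.2.2).max (h1.dist h2)
  have hne : ∀ x : X, ∀ u ∈ I, ∀ v ∈ I, v < u → φ u x ≠ φ v x := by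
    intro x u hu v hv huv h
    refine hT (φ v x) (u - v) (by linarith) (by linarith [hu.2, hv.1]) ?_
    rw [← φ.map_add, sub_add_cancel, h]
  -- A zero of `g` on `D` would be a point with a period in (0, T]; hence `g` has a positive lower
  -- bound on the compact set `D`.
  obtain ⟨a, ha, hmin⟩ := hD.exists_forall_le' hg.continuousOn (a := 0) (by
    rintro ⟨⟨u, v⟩, x, y⟩ ⟨⟨⟨hu, hv⟩, -⟩, huv⟩
    by_contra! hle
    have h1 : x = y := dist_le_zero.1 ((le_max_left _ _).trans hle)
    have h2 : φ u x = φ v y := dist_le_zero.1 ((le_max_right _ _).trans hle)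
    subst h1
    simp only [mem_ofPred_eq] at huv
    rcases lt_trichotomy u v with h | rfl | h
    · exact hne x v hv u hu h h2.symm
    · simp at huv
      linarith
    · exact hne x u hu v hv h h2)
  refine ⟨a / 2, by linarith, fun x y u hu v hv h1 h2 => ?_⟩
  by_contra! h
  have := hmin ((u, v), (x, y)) ⟨⟨⟨hu, hv⟩, mem_univ _⟩, h⟩
  have h3 : g ((u, v), (x, y)) ≤ a / 2 := max_le h1 h2
  linarith

/-- A reparametrization of a fixed-point free flow which shadows closely is nearly the identity. -/
theorem exists_abs_sub_le_of_shadow [CompactSpace X] {φ : Flow ℝ X} (hφ : NoFixedPoints φ)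
    {η : ℝ} (hη : 0 < η) :
    ∃ θ > 0, ∀ (x y : X) (t : ℝ) (α : ℝ → ℝ), ContinuousOn α (Icc 0 t) → α 0 = 0 →
      (∀ s ∈ Icc 0 t, dist (φ (α s) x) (φ s y) ≤ θ) →
      ∀ s ∈ Icc 0 t, |α s - s| ≤ η * (s + 1) := by
  obtain ⟨T, hT0, hT1, hT⟩ := exists_forall_ne_of_noFixedPoints hφ
  -- η T/4 is the error allowed per block of length T/4; T/8 keeps |α| below T/2 on one block, as
  -- T/8 + T/4 < T/2.
  set η' := min (η * (T / 4)) (T / 8)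
  have hη' : 0 < η' := by positivity
  obtain ⟨θ, hθ, h⟩ := exists_dist_time_lt hT hη'
  refine ⟨θ, hθ, ?_⟩
  have hloc : ∀ (x y : X) (t : ℝ) (α : ℝ → ℝ), ContinuousOn α (Icc 0 t) → α 0 = 0 →
      (∀ s ∈ Icc 0 t, dist (φ (α s) x) (φ s y) ≤ θ) → t ≤ T / 4 →
      ∀ s ∈ Icc 0 t, |α s - s| ≤ η' := by
    intro x y t α hα hα0 hsh ht
    have hxy : ∀ s ∈ Icc 0 t, dist x y ≤ θ := fun s hs => by
      simpa [hα0] using hsh 0 ⟨le_rfl, hs.1.trans hs.2⟩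
    have hstep : ∀ s ∈ Icc 0 t, |α s| ≤ T / 2 → |α s - s| < η' := fun s hs hle =>
      h x y _ (abs_le.1 hle) s ⟨by linarith [hs.1], by linarith [hs.2]⟩ (hxy s hs) (hsh s hs)
    intro s hs
    refine (hstep s hs ?_).le
    by_contra! hgt
    obtain ⟨u, hu, hu'⟩ := intermediate_value_Icc hs.1
      ((hα.mono (Icc_subset_Icc_right hs.2)).abs) (show T / 2 ∈ Icc |α 0| |α s| from
        ⟨by rw [hα0, abs_zero]; linarith, hgt.le⟩)
    have hu2 : u ∈ Icc 0 t := ⟨hu.1, hu.2.trans hs.2⟩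
    have h3 := hstep u hu2 hu'.le
    have h4 : |α u| ≤ |α u - u| + |u| := by simpa using abs_add_le (α u - u) u
    rw [abs_of_nonneg hu.1] at h4
    simp only at hu'
    linarith [min_le_right (η * (T / 4)) (T / 8), hu2.2]
  intro x y t α hα hα0 hsh
  have hind : ∀ n : ℕ, ∀ s ∈ Icc 0 t, s ≤ n * (T / 4) → |α s - s| ≤ n * η' := by
    intro n
    induction n with
    | zero =>
      intro s hs hsn
      have : s = 0 := le_antisymm (by simpa using hsn) hs.1
      simp [this, hα0]
    | succ n ih =>
      intro s hs hsn
      rcases le_or_gt s (n * (T / 4)) with hle | hlt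
      · refine (ih s hs hle).trans ?_
        push_cast
        linarith
      set s0 : ℝ := n * (T / 4) with hs0n
      have hs0 : 0 ≤ s0 := by positivity
      have h1 := ih s0 ⟨hs0, hlt.le.trans hs.2⟩ le_rfl
      have hmaps : ∀ u ∈ Icc 0 (s - s0), s0 + u ∈ Icc 0 t := fun u hu =>
        ⟨by linarith [hu.1], by linarith [hu.2, hs.2]⟩
      -- Shadowing restarts at time `s0` from the two current points, so errors add up block by
      -- block.
      have h2 := hloc (φ (α s0) x) (φ s0 y) (s - s0) (fun u => α (s0 + u) - α s0)
        ((hα.comp (by fun_prop) hmaps).sub continuousOn_const) (by simp) (fun u hu => by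
          rw [← φ.map_add, ← φ.map_add, sub_add_cancel, add_comm u]
          exact hsh _ (hmaps u hu))
        (by push_cast at hsn; rw [hs0n]; linarith) (s - s0) ⟨by linarith, le_rfl⟩
      simp only [add_sub_cancel] at h2
      calc |α s - s| = |(α s - α s0 - (s - s0)) + (α s0 - s0)| := by congr 1; ring
        _ ≤ _ := abs_add_le _ _
        _ ≤ η' + n * η' := add_le_add h2 h1
        _ = _ := by push_cast; ring
  intro s hs
  have hT4 : 0 < T / 4 := by linarith
  have h1 := Nat.le_ceil (s / (T / 4))
  have h2 := Nat.ceil_lt_add_one (div_nonneg hs.1 hT4.le)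
  rw [div_le_iff₀ hT4] at h1
  refine (hind _ s hs h1).trans ?_
  -- Rounding up to whole blocks costs at most one extra block, which the `+ 1` in the bound absorbs
  -- since T ≤ 1.
  calc (⌈s / (T / 4)⌉₊ : ℝ) * η' ≤ (s / (T / 4) + 1) * (η * (T / 4)) :=
        mul_le_mul h2.le (min_le_left _ _) hη'.le (by have := hs.1; positivity)
    _ = η * (s + T / 4) := by field_simp
    _ ≤ η * (s + 1) := by gcongr; linarith

/-! ### Geometry of reparametrization balls -/

theorem continuousOn_of_mem_rep {I : Set ℝ} {α : ℝ → ℝ} (hα : α ∈ Rep I) : ContinuousOn α I :=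
  continuousOn_iff_continuous_domRestrict.2 hα.1.continuous

theorem injOn_of_mem_rep {I : Set ℝ} {α : ℝ → ℝ} (hα : α ∈ Rep I) : InjOn α I :=
  injOn_iff_injective.2 hα.1.injective

theorem mem_rep_Icc {t : ℝ} {α : ℝ → ℝ} (hα : ContinuousOn α (Icc 0 t))
    (hinj : InjOn α (Icc 0 t)) (h0 : α 0 = 0) : α ∈ Rep (Icc 0 t) :=
  ⟨((continuousOn_iff_continuous_domRestrict.1 hα).isClosedEmbedding
    (injOn_iff_injective.1 hinj)).isEmbedding, h0⟩

theorem mem_rep_of_le {t t' : ℝ} (h : t' ≤ t) {α : ℝ → ℝ} (hα : α ∈ Rep (Icc 0 t)) :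
    α ∈ Rep (Icc 0 t') :=
  mem_rep_Icc ((continuousOn_of_mem_rep hα).mono (Icc_subset_Icc_right h))
    ((injOn_of_mem_rep hα).mono (Icc_subset_Icc_right h)) hα.2

theorem repBall_anti_time (φ : Flow ℝ X) (x : X) {t t' : ℝ} (h : t' ≤ t) (ε : ℝ) :
    repBall φ x t ε ⊆ repBall φ x t' ε := by
  rintro y ⟨α, hα, hy⟩
  exact ⟨α, mem_rep_of_le h hα, fun s hs => hy s (Icc_subset_Icc_right h hs)⟩

theorem repBall_subset_closedRepBall (φ : Flow ℝ X) (x : X) (t ε : ℝ) :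
    repBall φ x t ε ⊆ closedRepBall φ x t ε := by
  rintro y ⟨α, hα, hy⟩
  exact ⟨α, hα, fun s hs => (hy s hs).le⟩

theorem mem_closedRepBall_self (φ : Flow ℝ X) (x : X) (t : ℝ) {ε : ℝ} (h : 0 < ε) :
    x ∈ closedRepBall φ x t ε :=
  repBall_subset_closedRepBall φ x t ε (mem_repBall_self φ x t h)

/-- Nearby points stay close along a compact time interval. -/
theorem eventually_forall_dist_lt (φ : Flow ℝ X) (x : X) {C : Set ℝ} (hC : IsCompact C) {ε : ℝ}
    (hε : 0 < ε) : ∀ᶠ z in 𝓝 x, ∀ u ∈ C, dist (φ u x) (φ u z) < ε := by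
  refine hC.eventually_forall_of_forall_eventually fun u _ => ?_
  have hc : Continuous fun q : X × ℝ => dist (φ q.2 x) (φ q.2 q.1) :=
    (φ.continuous continuous_snd continuous_const).dist
      (φ.continuous continuous_snd continuous_fst)
  exact (isOpen_lt hc continuous_const).mem_nhds (by simpa using hε)

/-- Its use is that disjoint families of closed balls are countable, their interiors being nonempty.
-/
theorem closedRepBall_mem_nhds (φ : Flow ℝ X) (x : X) (t : ℝ) {ε : ℝ} (hε : 0 < ε) :
    closedRepBall φ x t ε ∈ 𝓝 x := by
  filter_upwards [eventually_forall_dist_lt φ x isCompact_Icc hε] with z hz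
  exact ⟨id, ⟨IsEmbedding.subtypeVal, rfl⟩, fun s hs => (hz s hs).le⟩

/-- `θ` is a shadowing scale with distortion `η`: reparametrizations which shadow at scale `θ`
deviate from the identity at most by the proportion `η`. -/
def IsShadowScale (φ : Flow ℝ X) (η θ : ℝ) : Prop :=
  ∀ (x y : X) (t : ℝ), ∀ α ∈ Rep (Icc 0 t), (∀ s ∈ Icc 0 t, dist (φ (α s) x) (φ s y) ≤ θ) →
    ∀ s ∈ Icc 0 t, |α s - s| ≤ η * (s + 1)

theorem exists_isShadowScale [CompactSpace X] {φ : Flow ℝ X} (hφ : NoFixedPoints φ) {η : ℝ}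
    (hη : 0 < η) : ∃ θ > 0, IsShadowScale φ η θ := by
  obtain ⟨θ, hθ, h⟩ := exists_abs_sub_le_of_shadow hφ hη
  exact ⟨θ, hθ, fun x y t α hα => h x y t α (continuousOn_of_mem_rep hα) hα.2⟩

theorem IsShadowScale.mono {φ : Flow ℝ X} {η θ θ' : ℝ} (h : IsShadowScale φ η θ) (hle : θ' ≤ θ) :
    IsShadowScale φ η θ' :=
  fun x y t α hα hs => h x y t α hα fun s hs' => (hs s hs').trans hle

/-- Not lying in a closed reparametrization ball is stable under small perturbations of both
points, at the price of a smaller scale. -/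
theorem IsShadowScale.exists_disjoint {φ : Flow ℝ X} {η ε ε' : ℝ} (h : IsShadowScale φ η ε)
    (hη : 0 ≤ η) (hε : ε' < ε) {x y : X} {m : ℝ} (hxy : y ∉ closedRepBall φ x m ε) :
    ∃ r > 0, ∀ z ∈ Metric.closedBall x r, Disjoint (repBall φ z m ε') (Metric.ball y (2 * r)) := by
  -- The shadowing bound confines every admissible α to this one compact set, so a single radius
  -- serves all `z` and all reparametrizations.
  set C : Set ℝ := Icc (-(m + η * (m + 1))) (m + η * (m + 1))
  have hd : 0 < (ε - ε') / 2 := by linarith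
  obtain ⟨a, ha, hxa⟩ := Metric.eventually_nhds_iff.1
    (eventually_forall_dist_lt φ x (C := C) isCompact_Icc hd)
  obtain ⟨b, hb, hyb⟩ := Metric.eventually_nhds_iff.1
    (eventually_forall_dist_lt φ y (C := Icc 0 m) isCompact_Icc hd)
  refine ⟨min (a / 2) (b / 2), by positivity, fun z hz => ?_⟩
  rw [Set.disjoint_left]
  rintro w ⟨α, hα, hw⟩ hwy
  refine hxy ⟨α, hα, fun s hs => ?_⟩
  have hz' : dist z x < a := by
    have := Metric.mem_closedBall.1 hz
    linarith [min_le_left (a / 2) (b / 2)]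
  have hw' : dist w y < b := by
    have := Metric.mem_ball.1 hwy
    linarith [min_le_right (a / 2) (b / 2)]
  have hαs : α s ∈ C := by
    have h1 := abs_le.1 (h z w m α hα (fun s hs => (hw s hs).le.trans hε.le) s hs)
    have h2 : η * (s + 1) ≤ η * (m + 1) := by
      gcongr
      exact hs.2
    have h3 := hs.1
    have h4 := hs.2
    exact ⟨by linarith, by linarith⟩
  have h1 := hxa hz' (α s) hαs
  have h2 := hyb hw' s hs
  have h3 := hw s hs
  rw [dist_comm] at h2
  linarith [dist_triangle4 (φ (α s) x) (φ (α s) z) (φ s w) (φ s y)]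

/-- The intermediate value theorem supplies preimages in [0, a]; σ is continuous because α is an
embedding and α ∘ σ is the inclusion. -/
theorem exists_rightInverse_of_mem_rep {t a : ℝ} {α : ℝ → ℝ} (hα : α ∈ Rep (Icc 0 t))
    (ha : a ∈ Icc 0 t) : ∃ σ : ℝ → ℝ, ContinuousOn σ (Icc 0 (α a)) ∧
      ∀ s ∈ Icc 0 (α a), σ s ∈ Icc 0 a ∧ α (σ s) = s := by
  have hex : ∀ s ∈ Icc 0 (α a), ∃ u ∈ Icc 0 a, α u = s := fun s hs =>
    intermediate_value_Icc ha.1 ((continuousOn_of_mem_rep hα).mono (Icc_subset_Icc_right ha.2))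
      (by rwa [hα.2])
  choose! σ hσ hασ using hex
  refine ⟨σ, ?_, fun s hs => ⟨hσ s hs, hασ s hs⟩⟩
  have hmem : ∀ s : Icc 0 (α a), σ s ∈ Icc 0 t := fun s => Icc_subset_Icc_right ha.2 (hσ s s.2)
  have hcont : Continuous fun s : Icc 0 (α a) => (⟨σ s, hmem s⟩ : Icc (0 : ℝ) t) := by
    rw [hα.1.continuous_iff]
    have : (Icc 0 t).domRestrict α ∘ (fun s : Icc 0 (α a) => (⟨σ s, hmem s⟩ : Icc (0 : ℝ) t)) =
        Subtype.val := funext fun s => hασ s s.2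
    rw [this]
    exact continuous_subtype_val
  exact continuousOn_iff_continuous_domRestrict.2 (continuous_subtype_val.comp hcont)

/-- If two closed reparametrization balls meet, then each centre lies in an open reparametrization
ball around the other one, with a larger radius and a slightly shorter time. -/
theorem IsShadowScale.mem_repBall_of_inter {φ : Flow ℝ X} {η δ : ℝ} (h : IsShadowScale φ η δ)
    (hη : 0 ≤ η) (hδ : 0 < δ) {x x' : X} {t t' a : ℝ} (ha : 1 ≤ a) (hat : a ≤ t)
    (hat' : a ≤ t') (hne : (closedRepBall φ x t δ ∩ closedRepBall φ x' t' δ).Nonempty) :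
    x ∈ repBall φ x' ((1 - 2 * η) * a) (3 * δ) := by
  obtain ⟨z, ⟨α, hα, hz⟩, β, hβ, hz'⟩ := hne
  have hamem : a ∈ Icc 0 t := ⟨by linarith, hat⟩
  -- Here 1 ≤ a turns the error η (a + 1) into at most 2 η a.
  have hαa : (1 - 2 * η) * a ≤ α a := by
    have := abs_le.1 (h x z t α hα hz a hamem)
    nlinarith
  obtain ⟨σ, hσ, hσ'⟩ := exists_rightInverse_of_mem_rep hα hamem
  have hsub : Icc 0 ((1 - 2 * η) * a) ⊆ Icc 0 (α a) := Icc_subset_Icc_right hαa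
  have hβa : β ∈ Rep (Icc 0 a) := mem_rep_of_le hat' hβ
  rcases lt_or_ge ((1 - 2 * η) * a) 0 with hneg | hnonneg
  · exact ⟨id, ⟨IsEmbedding.subtypeVal, rfl⟩, fun s hs => by linarith [hs.1, hs.2]⟩
  have hσ0 : σ 0 = 0 := by
    have h0 : (0 : ℝ) ∈ Icc 0 (α a) := hsub ⟨le_rfl, hnonneg⟩
    refine injOn_of_mem_rep hα (Icc_subset_Icc_right hat (hσ' 0 h0).1)
      ⟨le_rfl, hamem.1.trans hamem.2⟩ ?_
    rw [(hσ' 0 h0).2, hα.2]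
  -- The common point z at time σ s is δ-close both to x at time s and to x' at time β (σ s); 2δ <
  -- 3δ gives the strict inequality.
  refine ⟨β ∘ σ, mem_rep_Icc ?_ ?_ ?_, fun s hs => ?_⟩
  · exact (continuousOn_of_mem_rep hβa).comp (hσ.mono hsub) fun s hs => (hσ' s (hsub hs)).1
  · intro s hs s' hs' hss
    have := injOn_of_mem_rep hβa (hσ' s (hsub hs)).1 (hσ' s' (hsub hs')).1 hss
    rw [← (hσ' s (hsub hs)).2, this, (hσ' s' (hsub hs')).2]
  · simp [hσ0, hβ.2]
  · obtain ⟨hu, hαu⟩ := hσ' s (hsub hs)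
    have h1 := hz (σ s) (Icc_subset_Icc_right hat hu)
    have h2 := hz' (σ s) (Icc_subset_Icc_right hat' hu)
    rw [hαu, dist_comm] at h1
    simp only [Function.comp]
    linarith [dist_triangle (φ (β (σ s)) x') (φ (σ s) z) (φ s x)]

/-! ### Local entropy is bounded by packing entropy -/

theorem coe_le_neg_inv_mul_log_iff {T : ℝ} (hT : 0 < T) (s : ℝ) (m : ℝ≥0∞) :
    (s : EReal) ≤ ((-(1 / T) : ℝ) : EReal) * ENNReal.log m ↔
      m ≤ ENNReal.ofReal (Real.exp (-s * T)) := by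
  have hneg : -(1 / T) < 0 := by
    rw [neg_lt_zero]
    positivity
  induction m with
  | top =>
    rw [ENNReal.log_top, EReal.coe_mul_top_of_neg hneg]
    simp
  | coe m =>
    rcases eq_or_ne m 0 with rfl | hm
    · rw [ENNReal.coe_zero, ENNReal.log_zero, EReal.coe_mul_bot_of_neg hneg]
      simp
    · have hm' : 0 < (m : ℝ) := by positivity
      rw [← ENNReal.ofReal_coe_nnreal, ENNReal.log_ofReal_of_pos hm', ← EReal.coe_mul,
        EReal.coe_le_coe_iff, ENNReal.ofReal_le_ofReal_iff (Real.exp_pos _).le,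
        ← Real.log_le_iff_le_exp hm', neg_mul, neg_mul, one_div, inv_mul_eq_div, le_neg,
        div_le_iff₀ hT, neg_mul]

theorem packingPre_mono (φ : Flow ℝ X) (s : ℝ≥0) (ε : ℝ) {Z Z' : Set X} (h : Z ⊆ Z') :
    packingPre φ s ε Z ≤ packingPre φ s ε Z' :=
  iInf_mono fun _ => iSup₂_le fun F hF =>
    le_iSup₂_of_le F { hF with center_mem := fun p hp => h (hF.center_mem p hp) } le_rfl

theorem packingMeas_mono (φ : Flow ℝ X) (s : ℝ≥0) (ε : ℝ) {Z Z' : Set X} (h : Z ⊆ Z') :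
    packingMeas φ s ε Z ≤ packingMeas φ s ε Z' :=
  le_iInf₂ fun W hW => iInf₂_le W (h.trans hW)

/-- A mass distribution estimate for the packing premeasure. -/
theorem IsShadowScale.measure_le_packingPre [CompactSpace X] [MeasurableSpace X] {φ : Flow ℝ X}
    {η δ : ℝ} (h : IsShadowScale φ η δ) (hη : 0 < η) (hη' : η < 1 / 2) (hδ : 0 < δ)
    (μ : Measure X) {s s' : ℝ≥0} (hs : (s' : ℝ) = s * ((1 - 2 * η) * (1 - η))) {Z : Set X}
    (hZ : ∀ x ∈ Z, ∃ᶠ T in atTop, μ (repBall φ x T (3 * δ)) ≤ ENNReal.ofReal (Real.exp (-s * T))) :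
    μ Z ≤ packingPre φ s' δ Z := by
  refine le_iInf fun N => ?_
  have h1 : 0 < 1 - η := by linarith
  have h2 : 0 < 1 - 2 * η := by linarith
  set c := (1 - 2 * η) * (1 - η)
  have hc : 0 < c := mul_pos h2 h1
  -- With t = T / c the enlarged ball has time c t = T, and exp(-s T) = exp(-s' t).
  have hT : ∀ x ∈ Z, ∃ t : ℝ, (N : ℝ) ≤ t ∧ 1 ≤ (1 - η) * t ∧
      μ (repBall φ x (c * t) (3 * δ)) ≤ ENNReal.ofReal (Real.exp (-s' * t)) := by
    intro x hx
    obtain ⟨T, hT, hTμ⟩ := (((eventually_ge_atTop (c * N)).and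
      (eventually_ge_atTop (c / (1 - η)))).and_frequently (hZ x hx)).exists
    refine ⟨T / c, ?_, ?_, ?_⟩
    · rw [le_div_iff₀ hc]
      linarith [hT.1]
    · have := (div_le_iff₀ h1).1 hT.2
      rw [← mul_div_assoc, le_div_iff₀ hc]
      linarith
    · rw [mul_div_cancel₀ _ hc.ne', hs]
      have : -(s * c) * (T / c) = -s * T := by field_simp
      rwa [this]
  choose! t htN ht1 htμ using hT
  have htpos : ∀ x ∈ Z, 0 < t x := fun x hx => by
    have := ht1 x hx
    by_contra! hle
    nlinarith
  have hinv : ∀ x ∈ Z, 1 / t x ≤ 1 := fun x hx => by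
    rw [div_le_one (htpos x hx)]
    nlinarith [ht1 x hx, htpos x hx]
  -- The size of a ball is measured by 1 / t: each ball meets a selected one whose time is at most 1
  -- / (1 - η) times its own.
  obtain ⟨u, huZ, hud, hucov⟩ := Vitali.exists_disjoint_subfamily_covering_enlargement
    (fun x => closedRepBall φ x (t x) δ) Z (fun x => 1 / t x) (1 / (1 - η))
    (by rw [lt_div_iff₀ h1]; linarith) (fun x hx => (one_div_pos.2 (htpos x hx)).le) 1 hinv
    fun x _ => ⟨x, mem_closedRepBall_self φ x _ hδ⟩
  have hucount : u.Countable := hud.countable_of_nonempty_interior fun x _ =>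
    ⟨x, mem_interior_iff_mem_nhds.2 (closedRepBall_mem_nhds φ x _ hδ)⟩
  have hcov : Z ⊆ ⋃ x ∈ u, repBall φ x (c * t x) (3 * δ) := by
    intro x hx
    obtain ⟨b, hb, hne, hle⟩ := hucov x hx
    have hbpos := htpos b (huZ hb)
    have hxpos := htpos x hx
    have hle' : (1 - η) * t b ≤ t x := by
      rw [div_mul_div_comm, one_mul, div_le_div_iff₀ hxpos (mul_pos h1 hbpos)] at hle
      linarith
    refine mem_biUnion hb ?_
    have := h.mem_repBall_of_inter hη.le hδ (ht1 b (huZ hb)) hle' (by nlinarith) hne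
    rwa [← mul_assoc] at this
  have hinj : InjOn (fun x => (x, t x)) u := fun x _ y _ hxy => congrArg Prod.fst hxy
  refine (measure_mono hcov).trans ((measure_biUnion_le μ hucount _).trans ?_)
  refine le_iSup₂_of_le ((fun x => (x, t x)) '' u) ?_ ?_
  · refine ⟨hucount.image _, ?_, ?_, ?_, ?_⟩
    · rintro _ ⟨x, hx, rfl⟩
      exact huZ hx
    · rintro _ ⟨x, hx, rfl⟩
      exact htpos x (huZ hx)
    · rintro _ ⟨x, hx, rfl⟩
      exact htN x (huZ hx)
    · rintro _ ⟨x, hx, rfl⟩ _ ⟨y, hy, rfl⟩ hxy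
      exact hud hx hy fun hxy' => hxy (by simp only [hxy'])
  · rw [tsum_image (fun p : X × ℝ => ENNReal.ofReal (Real.exp (-s' * p.2))) hinj]
    exact ENNReal.tsum_le_tsum fun x => htμ x (huZ x.2)

theorem measure_upperLocalEntropyAt_gt_eq_zero [CompactSpace X] [MeasurableSpace X]
    {φ : Flow ℝ X} (hφ : NoFixedPoints φ) (μ : Measure X) (K : Set X) {s : ℝ≥0}
    (hs : packingEntropy φ K < s) {ε : ℝ} (hε : 0 < ε) :
    μ {x ∈ K | (s : EReal) < upperLocalEntropyAt φ μ x ε} = 0 := by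
  set A := {x ∈ K | (s : EReal) < upperLocalEntropyAt φ μ x ε}
  obtain ⟨r, hr, hrs⟩ := ENNReal.lt_iff_exists_nnreal_btwn.1 hs
  have hrs' : (r : ℝ) < s := by exact_mod_cast hrs
  have hspos : (0 : ℝ) < s := r.2.trans_lt hrs'
  -- Chosen so that s (1 - 2η)(1 - η) > s - 4ηs = r: the exponent lost to time distortion stays
  -- above the packing entropy.
  set η : ℝ := (s - r) / (4 * s)
  have hη : 0 < η := div_pos (by linarith) (by linarith)
  have hη' : η < 1 / 2 := by
    rw [div_lt_div_iff₀ (by linarith) two_pos]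
    linarith [r.2]
  have hηs : 4 * (η * s) = s - r := by
    simp only [η]
    field_simp
  obtain ⟨θ, hθ, hshadow⟩ := exists_isShadowScale hφ hη
  set δ := min θ (ε / 3)
  have hδ : 0 < δ := by positivity
  have hδε : 3 * δ ≤ ε := by linarith [min_le_right θ (ε / 3)]
  have hc : 0 < (1 - 2 * η) * (1 - η) := mul_pos (by linarith) (by linarith)
  let s' : ℝ≥0 := ⟨s * ((1 - 2 * η) * (1 - η)), by positivity⟩
  have hs' : (s' : ℝ) = s * ((1 - 2 * η) * (1 - η)) := rfl
  have hrs'' : r < s' := by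
    rw [← NNReal.coe_lt_coe, hs']
    nlinarith [mul_pos hη hspos, mul_pos (mul_pos hη hη) hspos]
  have hfreq : ∀ x ∈ A, ∃ᶠ T in atTop,
      μ (repBall φ x T (3 * δ)) ≤ ENNReal.ofReal (Real.exp (-s * T)) := by
    intro x hx
    have h1 := (frequently_lt_of_lt_limsup (by isBoundedDefault) hx.2).and_eventually
      (eventually_gt_atTop 0)
    refine h1.mono fun T hT => (measure_mono (repBall_mono φ x T hδε)).trans ?_
    exact (coe_le_neg_inv_mul_log_iff hT.2 s _).1 hT.1.le
  have hle : μ A ≤ packingMeas φ s' δ K := by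
    have hAK : A ⊆ K := fun x hx => hx.1
    refine le_trans (le_iInf₂ fun W hW => ?_) (packingMeas_mono φ s' δ hAK)
    have hcov : A ⊆ ⋃ i, W i ∩ A := fun x hx => by
      obtain ⟨i, hi⟩ := mem_iUnion.1 (hW hx)
      exact mem_iUnion.2 ⟨i, hi, hx⟩
    refine (measure_mono hcov).trans ((measure_iUnion_le _).trans ?_)
    refine ENNReal.tsum_le_tsum fun i => ?_
    exact ((hshadow.mono (min_le_left _ _)).measure_le_packingPre hη hη' hδ μ hs'
      fun x hx => hfreq x hx.2).trans (packingPre_mono φ s' δ inter_subset_left)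
  have hlt : packingEntropyAt φ K δ < s' :=
    ((le_iSup₂ (f := fun (ε : ℝ) (_ : 0 < ε) => packingEntropyAt φ K ε) δ hδ).trans_lt hr).trans
      (by exact_mod_cast hrs'')
  obtain ⟨q, hq⟩ := iInf_lt_iff.1 hlt
  obtain ⟨hq0, hq⟩ := iInf_lt_iff.1 hq
  rw [packingMeas_eq_zero φ (by exact_mod_cast hq) δ K (by rw [hq0]; exact ENNReal.zero_ne_top)]
    at hle
  exact le_antisymm hle bot_le

/-- Rational thresholds and scales 1 / (n + 1) reduce the almost everywhere bound to countably many
null sets; the integral comparison needs no measurability of the local entropy. -/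
theorem upperEntropy_le_packingEntropy [CompactSpace X] [MeasurableSpace X] [BorelSpace X]
    {φ : Flow ℝ X} (hφ : NoFixedPoints φ) {K : Set X} (hK : IsCompact K) (μ : Measure X)
    [IsProbabilityMeasure μ] (hμ : μ K = 1) : upperEntropy φ μ ≤ packingEntropy φ K := by
  have hKae : ∀ᵐ x ∂μ, x ∈ K := (prob_compl_eq_zero_iff hK.measurableSet).2 hμ
  have hnull : ∀ᵐ x ∂μ, ∀ (q : ℚ) (n : ℕ), packingEntropy φ K < (Real.toNNReal q : ℝ≥0) →
      ¬ (x ∈ K ∧ ((Real.toNNReal q : ℝ≥0) : EReal) < upperLocalEntropyAt φ μ x (1 / (n + 1))) := by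
    refine ae_all_iff.2 fun q => ae_all_iff.2 fun n => ?_
    by_cases hq : packingEntropy φ K < (Real.toNNReal q : ℝ≥0)
    · have := measure_upperLocalEntropyAt_gt_eq_zero hφ μ K hq (ε := 1 / (n + 1)) (by positivity)
      filter_upwards [measure_eq_zero_iff_ae_notMem.1 this] with x hx _ using hx
    · exact Eventually.of_forall fun x h => absurd h hq
  have hae : ∀ᵐ x ∂μ, (upperLocalEntropy φ μ x).toENNReal ≤ packingEntropy φ K := by
    filter_upwards [hKae, hnull] with x hxK hx
    by_contra! hlt
    obtain ⟨q, -, hq1, hq2⟩ := ENNReal.lt_iff_exists_rat_btwn.1 hlt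
    have hq2' : ((Real.toNNReal q : ℝ≥0) : EReal) < upperLocalEntropy φ μ x := by
      have h1 := EReal.coe_ennreal_lt_coe_ennreal_iff.2 hq2
      rwa [EReal.coe_toENNReal (upperLocalEntropy_nonneg φ μ x)] at h1
    obtain ⟨ε, hε⟩ := lt_iSup_iff.1 hq2'
    obtain ⟨hε0, hε⟩ := lt_iSup_iff.1 hε
    obtain ⟨n, hn⟩ := exists_nat_one_div_lt hε0
    exact hx q n hq1 ⟨hxK, hε.trans_le (upperLocalEntropyAt_antitone φ μ x hn.le)⟩
  calc upperEntropy φ μ ≤ ∫⁻ _, packingEntropy φ K ∂μ := lintegral_mono_ae hae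
    _ = packingEntropy φ K := by simp

/-! ### Localizing positive packing measure -/

theorem packingPre_empty (φ : Flow ℝ X) (s : ℝ≥0) (ε : ℝ) : packingPre φ s ε ∅ = 0 := by
  refine le_antisymm ((iInf_le _ 0).trans (iSup₂_le fun F hF => ?_)) bot_le
  have : F = ∅ := eq_empty_of_forall_notMem fun p hp => hF.center_mem p hp
  subst this
  simp

/-- A set of positive packing measure has a nonempty part of locally positive premeasure. -/
theorem exists_subset_locally_packingPre_ne_zero [CompactSpace X] (φ : Flow ℝ X) {s : ℝ≥0} {ε : ℝ}
    {K : Set X} (hK : packingMeas φ s ε K ≠ 0) :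
    ∃ Z ⊆ K, Z.Nonempty ∧ ∀ x ∈ Z, ∀ U ∈ 𝓝 x, packingPre φ s ε (Z ∩ U) ≠ 0 := by
  set M := OuterMeasure.ofFunction (packingPre φ s ε) (packingPre_empty φ s ε)
  -- `packingMeas` is definitionally the outer measure generated by `packingPre`.
  have hM : M K ≠ 0 := hK
  -- Removing the locally null points removes only a null set, so local positivity survives the
  -- restriction from K to Z.
  let Z : Set X := {x ∈ K | ∀ U ∈ 𝓝[K] x, M U ≠ 0}
  have hdiff : M (K \ Z) = 0 := by
    refine measure_null_of_locally_null _ fun x hx => ?_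
    by_contra! h
    exact hx.2 ⟨hx.1, fun U hU => h U (nhdsWithin_mono x sdiff_subset hU)⟩
  refine ⟨Z, fun x hx => hx.1, ?_, fun x hx U hU h0 => ?_⟩
  · by_contra! hemp
    rw [hemp, sdiff_empty] at hdiff
    exact hM hdiff
  · have h1 : M (Z ∩ U) = 0 := le_antisymm ((OuterMeasure.ofFunction_le _).trans h0.le) bot_le
    refine hx.2 (K ∩ U) (inter_mem_nhdsWithin K hU) ?_
    refine measure_mono_null (t := (Z ∩ U) ∪ (K \ Z)) (fun y hy => ?_)
      (measure_union_null h1 hdiff)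
    by_cases hyZ : y ∈ Z
    · exact Or.inl ⟨hyZ, hy.2⟩
    · exact Or.inr ⟨hy.1, hyZ⟩

/-- A nonzero premeasure at exponent t is infinite at any smaller s, so packing sums of every order
exceed 1, and already finite subsums do. -/
theorem exists_finset_isPacking (φ : Flow ℝ X) {s t : ℝ≥0} (hst : s < t) {ε : ℝ} {Z : Set X}
    (hZ : packingPre φ t ε Z ≠ 0) (N : ℕ) : ∃ E : Finset (X × ℝ), IsPacking φ Z ε N E ∧
      1 ≤ ∑ p ∈ E, ENNReal.ofReal (Real.exp (-s * p.2)) := by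
  have htop : packingPre φ s ε Z = ∞ := by
    by_contra h
    exact hZ (packingPre_eq_zero φ hst ε Z h)
  have hlt : 1 < packingPreAt φ s ε N Z :=
    ENNReal.one_lt_top.trans_le (htop.ge.trans (iInf_le _ N))
  obtain ⟨F, hF⟩ := lt_iSup_iff.1 hlt
  obtain ⟨hF, hsum⟩ := lt_iSup_iff.1 hF
  rw [ENNReal.tsum_eq_iSup_sum] at hsum
  obtain ⟨G, hG⟩ := lt_iSup_iff.1 hsum
  refine ⟨G.map (Function.Embedding.subtype _), ?_, ?_⟩
  · have hsub : (↑(G.map (Function.Embedding.subtype _)) : Set (X × ℝ)) ⊆ F := by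
      intro p hp
      simp only [Finset.coe_map, mem_image] at hp
      obtain ⟨q, -, rfl⟩ := hp
      exact q.2
    exact ⟨hF.countable.mono hsub, fun p hp => hF.center_mem p (hsub hp),
      fun p hp => hF.time_pos p (hsub hp), fun p hp => hF.le_time p (hsub hp),
      hF.disjoint.subset hsub⟩
  · rw [Finset.sum_map]
    exact hG.le

/-! ### Nested finite packings -/

/-- A finite weighted family of pairs (centre, time), with weights at most `exp (-s t)`, whose
reparametrization balls at scale `ε` stay away from the other centres when the centre is moved
by at most `radius`. -/
structure Stage (φ : Flow ℝ X) (s : ℝ≥0) (Z : Set X) (ε : ℝ) where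
  carrier : Finset (X × ℝ)
  weight : X × ℝ → ℝ≥0∞
  radius : ℝ
  radius_pos : 0 < radius
  center_mem : ∀ a ∈ carrier, a.1 ∈ Z
  sum_weight : ∑ a ∈ carrier, weight a = 1
  weight_le : ∀ a ∈ carrier, weight a ≤ ENNReal.ofReal (Real.exp (-s * a.2))
  separated : ∀ a ∈ carrier, ∀ b ∈ carrier, a ≠ b → ∀ z ∈ Metric.closedBall a.1 radius,
    Disjoint (repBall φ z a.2 ε) (Metric.ball b.1 (2 * radius))

namespace Stage

variable {φ : Flow ℝ X} {s : ℝ≥0} {Z : Set X} {ε : ℝ}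

/-- `B` refines `A` if the weight of each element of `A` is redistributed over elements of `B`
whose balls are contained in its ball. -/
def Refines (A B : Stage φ s Z ε) : Prop :=
  open Classical in
  ∃ p : X × ℝ → X × ℝ, (∀ b ∈ B.carrier, p b ∈ A.carrier) ∧
    (∀ b ∈ B.carrier, Metric.closedBall b.1 B.radius ⊆ Metric.closedBall (p b).1 A.radius) ∧
    ∀ a ∈ A.carrier, ∑ b ∈ B.carrier with p b = a, B.weight b = A.weight a

theorem Refines.refl (A : Stage φ s Z ε) : Refines A A := by
  classical
  refine ⟨id, fun b hb => hb, fun b _ => Subset.rfl, fun a ha => ?_⟩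
  simp [Finset.filter_eq', ha]

theorem Refines.trans {A B C : Stage φ s Z ε} (hAB : Refines A B) (hBC : Refines B C) :
    Refines A C := by
  classical
  obtain ⟨p, hp, hpball, hpsum⟩ := hAB
  obtain ⟨q, hq, hqball, hqsum⟩ := hBC
  refine ⟨p ∘ q, fun c hc => hp _ (hq c hc),
    fun c hc => (hqball c hc).trans (hpball _ (hq c hc)), fun a ha => ?_⟩
  rw [← hpsum a ha, ← Finset.sum_fiberwise_of_maps_to (s := C.carrier.filter fun c => (p ∘ q) c = a)
    (t := B.carrier.filter fun b => p b = a) (g := q)]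
  · refine Finset.sum_congr rfl fun b hb => ?_
    rw [Finset.mem_filter] at hb
    rw [← hqsum b hb.1, Finset.filter_filter]
    refine Finset.sum_congr (Finset.filter_congr fun c _ => ?_) fun _ _ => rfl
    constructor
    · exact fun h => h.2
    · rintro rfl
      exact ⟨hb.2, rfl⟩
  · intro c hc
    rw [Finset.mem_filter] at hc ⊢
    exact ⟨hq c hc.1, hc.2⟩

theorem weight_le_one (A : Stage φ s Z ε) {a : X × ℝ} (ha : a ∈ A.carrier) : A.weight a ≤ 1 := by
  rw [← A.sum_weight]
  exact Finset.single_le_sum (f := A.weight) (fun _ _ => bot_le) ha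

/-- The stage consisting of a single point. -/
noncomputable def single {x : X} (hx : x ∈ Z) : Stage φ s Z ε where
  -- Time 0 makes the weight bound read 1 ≤ exp 0.
  carrier := {(x, 0)}
  weight _ := 1
  radius := 1
  radius_pos := one_pos
  center_mem a ha := by
    rw [Finset.mem_singleton.1 ha]
    exact hx
  sum_weight := by simp
  weight_le a ha := by
    rw [Finset.mem_singleton.1 ha]
    simp
  separated a ha b hb hab := by
    rw [Finset.mem_singleton.1 ha, Finset.mem_singleton.1 hb] at hab
    exact absurd rfl hab

/-- Each centre is replaced by a packing close to it, its weight being shared in proportion to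
exp(-s t). Siblings are separated by disjointness of the packing and the gap ε < ε'; children of
different parents inherit their parents' separation. -/
theorem exists_refines {η ε' : ℝ} (hshadow : IsShadowScale φ η ε') (hη : 0 ≤ η) (hε : 0 < ε)
    (hεε' : ε < ε')
    (hZ : ∀ x ∈ Z, ∀ U ∈ 𝓝 x, ∀ N : ℕ, ∃ E : Finset (X × ℝ), IsPacking φ (Z ∩ U) ε' N E ∧
      1 ≤ ∑ p ∈ E, ENNReal.ofReal (Real.exp (-s * p.2)))
    (A : Stage φ s Z ε) (N : ℕ) :
    ∃ B : Stage φ s Z ε, Refines A B ∧ ∀ b ∈ B.carrier, (N : ℝ) ≤ b.2 := by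
  classical
  -- Times must also exceed all earlier ones, so that a child's ball lies in the ball of its
  -- parent's time about the same centre.
  obtain ⟨N', hNN', hN'⟩ : ∃ N' : ℕ, N ≤ N' ∧ ∀ a ∈ A.carrier, a.2 ≤ N' := by
    obtain ⟨M, hM⟩ := (A.carrier.image Prod.snd).exists_le
    refine ⟨max N ⌈M⌉₊, le_max_left _ _, fun a ha => ?_⟩
    exact (hM _ (Finset.mem_image_of_mem _ ha)).trans
      ((Nat.le_ceil M).trans (by exact_mod_cast le_max_right _ _))
  set r := A.radius
  have hr : 0 < r := A.radius_pos
  choose! E hE hEsum using fun a ha =>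
    hZ a.1 (A.center_mem a ha) _ (Metric.ball_mem_nhds a.1 (half_pos hr)) N'
  have hEdist : ∀ a ∈ A.carrier, ∀ q ∈ E a, dist q.1 a.1 < r / 2 := fun a ha q hq =>
    ((hE a ha).center_mem q hq).2
  have huniq : ∀ a ∈ A.carrier, ∀ b ∈ A.carrier, ∀ q ∈ E a, q ∈ E b → a = b := by
    intro a ha b hb q hqa hqb
    by_contra hab
    refine Set.disjoint_left.1 (A.separated a ha b hb hab q.1 ?_) (mem_repBall_self φ q.1 _ hε) ?_
    · rw [Metric.mem_closedBall]
      linarith [hEdist a ha q hqa]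
    · rw [Metric.mem_ball]
      linarith [hEdist b hb q hqb]
  set S := A.carrier.biUnion E
  have hS : ∀ q ∈ S, ∃ a ∈ A.carrier, q ∈ E a := fun q hq => Finset.mem_biUnion.1 hq
  choose! p hpA hpE using hS
  have hfib : ∀ a ∈ A.carrier, S.filter (fun q => p q = a) = E a := by
    intro a ha
    ext q
    rw [Finset.mem_filter]
    constructor
    · rintro ⟨hq, rfl⟩
      exact hpE q hq
    · intro hq
      have hqS : q ∈ S := Finset.mem_biUnion.2 ⟨a, ha, hq⟩
      exact ⟨hqS, huniq _ (hpA q hqS) a ha q (hpE q hqS) hq⟩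
  let e : X × ℝ → ℝ≥0∞ := fun q => ENNReal.ofReal (Real.exp (-s * q.2))
  let w : X × ℝ → ℝ≥0∞ := fun q => A.weight (p q) * (e q / ∑ q' ∈ E (p q), e q')
  have hwsum : ∀ a ∈ A.carrier, ∑ q ∈ S with p q = a, w q = A.weight a := by
    intro a ha
    have h1 : ∀ q ∈ S.filter (fun q => p q = a), w q = A.weight a * (e q / ∑ q' ∈ E a, e q') := by
      intro q hq
      simp only [w, (Finset.mem_filter.1 hq).2]
    rw [Finset.sum_congr rfl h1, hfib a ha, ← Finset.mul_sum]
    simp only [div_eq_mul_inv]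
    rw [← Finset.sum_mul, ENNReal.mul_inv_cancel, mul_one]
    · exact (one_pos.trans_le (hEsum a ha)).ne'
    · exact ENNReal.sum_ne_top.2 fun _ _ => ENNReal.ofReal_ne_top
  have hsep : ∀ q ∈ S, ∀ q' ∈ S, ∀ᶠ ρ in 𝓝[>] (0 : ℝ), q ≠ q' → ∀ z ∈ Metric.closedBall q.1 ρ,
      Disjoint (repBall φ z q.2 ε) (Metric.ball q'.1 (2 * ρ)) := by
    intro q hq q' hq'
    by_cases hpq : p q = p q'
    · by_cases hqq' : q = q'
      · exact Eventually.of_forall fun ρ h => absurd hqq' h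
      have hdisj := (hE _ (hpA q hq)).disjoint (hpE q hq)
        (show q' ∈ (E (p q) : Set (X × ℝ)) by rw [hpq]; exact hpE q' hq') hqq'
      obtain ⟨ρ, hρ, h⟩ := hshadow.exists_disjoint hη hεε' fun hmem =>
        Set.disjoint_left.1 hdisj hmem (mem_closedRepBall_self φ q'.1 q'.2 (hε.trans hεε'))
      filter_upwards [Ioc_mem_nhdsGT hρ] with ρ' hρ' _ z hz
      exact (h z (Metric.closedBall_subset_closedBall hρ'.2 hz)).mono_right
        (Metric.ball_subset_ball (by linarith [hρ'.2]))
    · filter_upwards [Ioc_mem_nhdsGT (half_pos hr)] with ρ hρ _ z hz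
      have h1 := hEdist _ (hpA q hq) q (hpE q hq)
      have h2 := hEdist _ (hpA q' hq') q' (hpE q' hq')
      refine (A.separated _ (hpA q hq) _ (hpA q' hq') hpq z ?_).mono ?_ ?_
      · exact Metric.closedBall_subset_closedBall' (by linarith [hρ.2]) hz
      · exact repBall_anti_time φ z ((hN' _ (hpA q hq)).trans
          ((hE _ (hpA q hq)).le_time q (hpE q hq))) ε
      · exact Metric.ball_subset_ball' (by linarith [hρ.2])
  have hsep' : ∀ᶠ ρ in 𝓝[>] (0 : ℝ), ∀ q ∈ S, ∀ q' ∈ S, q ≠ q' →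
      ∀ z ∈ Metric.closedBall q.1 ρ, Disjoint (repBall φ z q.2 ε) (Metric.ball q'.1 (2 * ρ)) := by
    rw [eventually_all_finset]
    intro q hq
    rw [eventually_all_finset]
    exact hsep q hq
  obtain ⟨ρ, hρsep, hρ⟩ := (hsep'.and (Ioc_mem_nhdsGT (half_pos hr))).exists
  refine ⟨⟨S, w, ρ, hρ.1, ?_, ?_, ?_, hρsep⟩, ⟨p, hpA, ?_, hwsum⟩, ?_⟩
  · exact fun q hq => ((hE _ (hpA q hq)).center_mem q (hpE q hq)).1
  · rw [← Finset.sum_fiberwise_of_maps_to hpA, Finset.sum_congr rfl hwsum, A.sum_weight]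
  · intro q hq
    -- The parent's weight is at most 1 and the normalizing sum at least 1.
    calc w q ≤ 1 * (e q / 1) :=
          mul_le_mul' (A.weight_le_one (hpA q hq)) (ENNReal.div_le_div_left (hEsum _ (hpA q hq)) _)
      _ = e q := by simp
  · intro q hq
    exact Metric.closedBall_subset_closedBall'
      (by have := hEdist _ (hpA q hq) q (hpE q hq); linarith [hρ.2])
  · intro q hq
    exact (Nat.cast_le.2 hNN').trans ((hE _ (hpA q hq)).le_time q (hpE q hq))

/-- The union of the closed balls of a stage. -/
def region (A : Stage φ s Z ε) : Set X :=
  ⋃ a ∈ A.carrier, Metric.closedBall a.1 A.radius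

theorem isClosed_region (A : Stage φ s Z ε) : IsClosed A.region :=
  isClosed_biUnion_finset fun _ _ => Metric.isClosed_closedBall

variable [MeasurableSpace X]

/-- The sum of the weighted point masses of a stage. -/
noncomputable def measure (A : Stage φ s Z ε) : Measure X :=
  ∑ a ∈ A.carrier, A.weight a • Measure.dirac a.1

theorem measure_apply (A : Stage φ s Z ε) {C : Set X} (hC : MeasurableSet C) :
    A.measure C = ∑ a ∈ A.carrier, A.weight a * C.indicator 1 a.1 := by
  simp [measure, Measure.finsetSum_apply, Measure.dirac_apply' _ hC]

theorem measure_eq_one (A : Stage φ s Z ε) {C : Set X} (hC : MeasurableSet C)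
    (h : ∀ a ∈ A.carrier, a.1 ∈ C) : A.measure C = 1 := by
  rw [A.measure_apply hC, ← A.sum_weight]
  exact Finset.sum_congr rfl fun a ha => by simp [h a ha]

instance isProbabilityMeasure_measure (A : Stage φ s Z ε) : IsProbabilityMeasure A.measure :=
  ⟨A.measure_eq_one MeasurableSet.univ fun _ _ => mem_univ _⟩

theorem Refines.measure_region [BorelSpace X] {A B : Stage φ s Z ε} (h : Refines A B) :
    B.measure A.region = 1 := by
  obtain ⟨p, hp, hball, -⟩ := h
  refine B.measure_eq_one A.isClosed_region.measurableSet fun b hb => ?_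
  exact mem_biUnion (hp b hb) (hball b hb (Metric.mem_closedBall_self B.radius_pos.le))

/-- Descendants of another element lie in that element's closed ball, which by separation misses the
doubled ball of `a`; only descendants of `a` contribute. -/
theorem Refines.measure_ball_le [BorelSpace X] {A B : Stage φ s Z ε} (hε : 0 < ε)
    (h : Refines A B) {a : X × ℝ} (ha : a ∈ A.carrier) :
    B.measure (Metric.ball a.1 (2 * A.radius)) ≤ A.weight a := by
  classical
  obtain ⟨p, hp, hball, hsum⟩ := h
  rw [B.measure_apply Metric.isOpen_ball.measurableSet, ← hsum a ha, Finset.sum_filter]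
  refine Finset.sum_le_sum fun b hb => ?_
  split_ifs with hpb
  · exact mul_le_of_le_one_right' (indicator_le_self _ _ _)
  · rw [indicator_of_notMem, mul_zero]
    refine Set.disjoint_left.1 (A.separated _ (hp b hb) a ha hpb b.1 ?_)
      (mem_repBall_self φ b.1 _ hε)
    exact hball b hb (Metric.mem_closedBall_self B.radius_pos.le)

/-- A measure which lives on the balls of a stage and respects its weights gives small mass to
reparametrization balls. -/
theorem exists_measure_repBall_le (A : Stage φ s Z ε) {μ : Measure X}
    (hregion : μ A.regionᶜ = 0)
    (hball : ∀ a ∈ A.carrier, μ (Metric.ball a.1 (2 * A.radius)) ≤ A.weight a) {z : X}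
    (hz : z ∈ A.region) : ∃ a ∈ A.carrier,
      μ (repBall φ z a.2 ε) ≤ ENNReal.ofReal (Real.exp (-s * a.2)) := by
  obtain ⟨a, ha, hza⟩ := mem_iUnion₂.1 hz
  refine ⟨a, ha, ?_⟩
  have hr := A.radius_pos
  have hsub : repBall φ z a.2 ε ⊆ Metric.ball a.1 (2 * A.radius) ∪ A.regionᶜ := by
    intro y hy
    by_cases hyr : y ∈ A.region
    · obtain ⟨b, hb, hyb⟩ := mem_iUnion₂.1 hyr
      have hyb' : y ∈ Metric.ball b.1 (2 * A.radius) :=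
        Metric.closedBall_subset_ball (by linarith) hyb
      by_cases hab : a = b
      · subst hab
        exact Or.inl hyb'
      · exact absurd hyb' (Set.disjoint_left.1 (A.separated a ha b hb hab z hza) hy)
    · exact Or.inr hyr
  calc μ (repBall φ z a.2 ε) ≤ μ (Metric.ball a.1 (2 * A.radius)) + μ A.regionᶜ :=
        (measure_mono hsub).trans (measure_union_le _ _)
    _ ≤ A.weight a := by rw [hregion, add_zero]; exact hball a ha
    _ ≤ _ := A.weight_le a ha

end Stage

/-! ### The limit measure and the reverse inequality -/

theorem exists_measure_frequently_repBall_le [CompactSpace X] [MeasurableSpace X] [BorelSpace X]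
    {φ : Flow ℝ X} {η ε ε' : ℝ} (hshadow : IsShadowScale φ η ε') (hη : 0 ≤ η) (hε : 0 < ε)
    (hεε' : ε < ε') {s : ℝ≥0} {Z K : Set X} (hZne : Z.Nonempty) (hZK : Z ⊆ K) (hK : IsClosed K)
    (hZ : ∀ x ∈ Z, ∀ U ∈ 𝓝 x, ∀ N : ℕ, ∃ E : Finset (X × ℝ), IsPacking φ (Z ∩ U) ε' N E ∧
      1 ≤ ∑ p ∈ E, ENNReal.ofReal (Real.exp (-s * p.2))) :
    ∃ μ : Measure X, IsProbabilityMeasure μ ∧ μ K = 1 ∧ ∀ᵐ z ∂μ, ∃ᶠ T in atTop,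
      μ (repBall φ z T ε) ≤ ENNReal.ofReal (Real.exp (-s * T)) := by
  obtain ⟨x₀, hx₀⟩ := hZne
  choose next hnext hnext_le using
    Stage.exists_refines (s := s) (Z := Z) (φ := φ) (ε := ε) hshadow hη hε hεε' hZ
  obtain ⟨A, hAsucc⟩ : ∃ A : ℕ → Stage φ s Z ε, ∀ n, A (n + 1) = next (A n) n :=
    ⟨fun n => Nat.rec (Stage.single hx₀) (fun n B => next B n) n, fun _ => rfl⟩
  have hA : ∀ i j, i ≤ j → (A i).Refines (A j) := by
    intro i j hij
    induction j, hij using Nat.le_induction with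
    | base => exact Stage.Refines.refl _
    | succ j _ ih => exact ih.trans (hAsucc j ▸ hnext (A j) j)
  let P : ℕ → ProbabilityMeasure X := fun n => ⟨(A n).measure, (A n).isProbabilityMeasure_measure⟩
  -- Along an ultrafilter the measures converge, the space of probability measures on X being
  -- compact.
  set L : Filter ℕ := (hyperfilter ℕ : Filter ℕ)
  have hL : ∀ i, ∀ᶠ j in L, i ≤ j := fun i => Nat.hyperfilter_le_atTop (eventually_ge_atTop i)
  obtain ⟨μ, hμ⟩ : ∃ μ : ProbabilityMeasure X, Tendsto P L (𝓝 μ) :=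
    ⟨_, ((hyperfilter ℕ).map P).le_nhds_lim⟩
  have hclosed : ∀ C : Set X, IsClosed C → (∀ᶠ j in L, (A j).measure C = 1) →
      (μ : Measure X) C = 1 := by
    intro C hC h
    refine le_antisymm prob_le_one ?_
    refine le_trans ?_ (ProbabilityMeasure.limsup_measure_closed_le_of_tendsto hμ hC)
    refine le_limsup_of_frequently_le (Eventually.frequently ?_)
    exact h.mono fun j hj => hj.ge
  have hregion : ∀ i, (μ : Measure X) (A i).region = 1 := fun i =>
    hclosed _ (A i).isClosed_region ((hL i).mono fun j hij => (hA i j hij).measure_region)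
  have hregion' : ∀ i, (μ : Measure X) (A i).regionᶜ = 0 := fun i =>
    (prob_compl_eq_zero_iff (A i).isClosed_region.measurableSet).2 (hregion i)
  -- Mass bounds pass to the limit on open sets and full mass on closed ones, hence open doubled
  -- balls here and closed balls in `region`.
  have hball : ∀ i, ∀ a ∈ (A i).carrier,
      (μ : Measure X) (Metric.ball a.1 (2 * (A i).radius)) ≤ (A i).weight a := by
    intro i a ha
    refine (ProbabilityMeasure.le_liminf_measure_open_of_tendsto hμ Metric.isOpen_ball).trans ?_
    refine liminf_le_of_frequently_le (Eventually.frequently ?_)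
    exact (hL i).mono fun j hij => (hA i j hij).measure_ball_le hε ha
  refine ⟨μ, inferInstance, hclosed K hK (Eventually.of_forall fun j => ?_), ?_⟩
  · exact (A j).measure_eq_one hK.measurableSet fun a ha => hZK ((A j).center_mem a ha)
  · filter_upwards [ae_all_iff.2 hregion'] with z hz
    refine frequently_atTop.2 fun T => ?_
    obtain ⟨n, hn⟩ := exists_nat_ge T
    -- Stage n + 1 is the one whose times are at least n.
    obtain ⟨a, ha, hle⟩ := (A (n + 1)).exists_measure_repBall_le (hregion' (n + 1))
      (hball (n + 1)) (hz (n + 1))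
    exact ⟨a.2, hn.trans (hnext_le (A n) n a (hAsucc n ▸ ha)), hle⟩

theorem packingEntropy_le_iSup_upperEntropy [CompactSpace X] [MeasurableSpace X] [BorelSpace X]
    {φ : Flow ℝ X} (hφ : NoFixedPoints φ) {K : Set X} (hK : IsClosed K) :
    packingEntropy φ K ≤
      ⨆ (μ : Measure X) (_ : IsProbabilityMeasure μ) (_ : μ K = 1), upperEntropy φ μ := by
  refine ENNReal.le_of_forall_nnreal_lt fun s hs => ?_
  obtain ⟨ε₀, hε₀⟩ := lt_iSup_iff.1 hs
  obtain ⟨hε₀pos, hε₀⟩ := lt_iSup_iff.1 hε₀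
  -- Distortion 1 suffices: this direction only needs reparametrizations confined to a compact set.
  obtain ⟨θ, hθ, hshadow⟩ := exists_isShadowScale hφ one_pos
  set ε := min ε₀ θ
  have hε : 0 < ε := by positivity
  obtain ⟨t, hst, ht⟩ := ENNReal.lt_iff_exists_nnreal_btwn.1
    (hε₀.trans_le (packingEntropyAt_antitone φ K (min_le_left ε₀ θ)))
  have hmeas : packingMeas φ t ε K ≠ 0 := fun h => absurd (iInf₂_le t h) (not_le.2 ht)
  obtain ⟨Z, hZK, hZne, hZ⟩ := exists_subset_locally_packingPre_ne_zero φ hmeas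
  obtain ⟨μ, hμ, hμK, hae⟩ := exists_measure_frequently_repBall_le
    (hshadow.mono (min_le_right ε₀ θ)) zero_le_one (half_pos hε) (half_lt_self hε) hZne hZK hK
    fun x hx U hU N => exists_finset_isPacking φ (by exact_mod_cast hst) (hZ x hx U hU) N
  refine le_iSup_of_le μ (le_iSup₂_of_le hμ hμK ?_)
  calc (s : ℝ≥0∞) = ∫⁻ _, (s : ℝ≥0∞) ∂μ := by simp
    _ ≤ upperEntropy φ μ := lintegral_mono_ae ?_
  filter_upwards [hae] with z hz
  have h1 : ((s : ℝ) : EReal) ≤ upperLocalEntropy φ μ z := by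
    refine le_iSup₂_of_le (ε / 2) (half_pos hε) (le_limsup_of_frequently_le ?_)
    exact (hz.and_eventually (eventually_gt_atTop 0)).mono fun T hT =>
      (coe_le_neg_inv_mul_log_iff hT.2 s _).2 hT.1
  have h2 := EReal.toENNReal_le_toENNReal h1
  simpa using h2

end FlowEntropy

/-- Variational principle for packing topological entropy of fixed-point free flows. -/
theorem mainTheorem1 {X : Type*} [MetricSpace X] [CompactSpace X] [MeasurableSpace X]
    [BorelSpace X] (φ : Flow ℝ X) (hφ : FlowEntropy.NoFixedPoints φ)
    (K : Set X) (hK : IsCompact K) (hne : K.Nonempty) :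
    FlowEntropy.packingEntropy φ K =
      ⨆ (μ : Measure X) (_ : IsProbabilityMeasure μ) (_ : μ K = 1),
        FlowEntropy.upperEntropy φ μ :=
  le_antisymm (FlowEntropy.packingEntropy_le_iSup_upperEntropy hφ hK.isClosed)
    (iSup_le fun μ => iSup₂_le fun _ hμ => FlowEntropy.upperEntropy_le_packingEntropy hφ hK μ hμ)
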